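/- Let $d\ge 1$. Let $q(x,y)$ be the transition probability of a Markov chain $Y=(Y_k)_{k\ge0}$ on $\mathbb Z^d$, and let $\bar q(x,y)=\bar q(y,x)=\bar q(0,y-x)$ be the transition probability of a symmetric random walk $\bar Y=(\bar Y_k)_{k\ge 0}$ on $\mathbb Z^d$. Write $P_x,E_x$ for probability and expectation when the initial state is $x$, write $x=(x^1,\dots,x^d)$ for the coordinates of a vector, and let $|x|$ be the Euclidean norm. Assume: (A.i) $E_0|\bar Y_1|^3<\infty$. (A.ii) There are an index $j\in\{1,\dots,d\}$ and a constant $\kappa_0>0$ such that either $P_x\{Y_1^j-Y_0^j\ge 1\}\ge\kappa_0$ for all $x\in\mathbb Z^d$, or $P_x\{Y_1^j-Y_0^j\le -1\}\ge\kappa_0$ for all $x\in\mathbb Z^d$. Furthermore, for every $i\in\{1,\dots,d\}$, if $\bar q(0,y)=0$ for all $y$ with $y^i\ne0$, then $q(x,y)=0$ whenever $x^i\ne y^i$. (A.iii) There are constants $0<C_1,\alpha_1<\infty$ such that for every $x\in\mathbb Z^d$ the one-step distributions $q(x,\cdot)$ and $\bar q(x,\cdot)$ have a coupling $(Y_1,\bar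 Y_1)$, with law denoted $P_{x,x}$, such that $P_{x,x}[Y_1\ne\bar Y_1]\le C_1e^{-\alpha_1|x|}$. Let $h:\mathbb Z^d\to\mathbb R$ satisfy $0\le h(x)\le C_2e^{-\alpha_2|x|}$ for all $x$, for some constants $0<C_2,\alpha_2<\infty$. Then there are constants $0<C,\eta<\infty$ such that $$\sum_{k=0}^{n-1}E_z h(Y_k)=\sum_{y\in\mathbb Z^d} h(y)\sum_{k=0}^{n-1}P_z(Y_k=y)\le Cn^{1-\eta}\qquad\text{for all } n\ge1 \text{ and all } z\in\mathbb Z^d.$$ -/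

import Mathlib

open MeasureTheory

/-- The Euclidean norm `|x|` of a lattice point `x ∈ ℤ^d`. -/
noncomputable def latticeNorm {d : ℕ} (x : Fin d → ℤ) : ℝ :=
  ‖WithLp.toLp 2 (fun i => (x i : ℝ))‖

/-- Under the probability measure `P`, the process `Y` is a Markov chain on `ℤ^d` with transition
probability `q(x,y)` and initial state `z`:
`P[Y_0 = x_0, …, Y_n = x_n] = 1{x_0 = z} q(x_0,x_1) ⋯ q(x_{n-1},x_n)`. -/
structure IsMarkovChainFrom {d : ℕ} (q : (Fin d → ℤ) → PMF (Fin d → ℤ)) (z : Fin d → ℤ)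
    {Ω : Type*} [MeasurableSpace Ω] (P : Measure Ω) (Y : ℕ → Ω → (Fin d → ℤ)) : Prop where
  isProbabilityMeasure : IsProbabilityMeasure P
  measurable : ∀ k, Measurable (Y k)
  law : ∀ (n : ℕ) (x : ℕ → (Fin d → ℤ)),
    P {ω | ∀ k ≤ n, Y k ω = x k} =
      (if x 0 = z then 1 else 0) * ∏ k ∈ Finset.range n, q (x k) (x (k + 1))

/-- `q̄` is the transition probability of a symmetric random walk on `ℤ^d`:
`q̄(x,y) = q̄(y,x) = q̄(0,y-x)`. -/
def IsSymmetricRandomWalk {d : ℕ} (qbar : (Fin d → ℤ) → PMF (Fin d → ℤ)) : Prop :=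
  ∀ x y, qbar x y = qbar y x ∧ qbar x y = qbar 0 (y - x)

/-- The third moment bound `E_0 |Ȳ_1|³ < ∞`. -/
def HasThirdMoment {d : ℕ} (qbar : (Fin d → ℤ) → PMF (Fin d → ℤ)) : Prop :=
  ∑' y, qbar 0 y * ENNReal.ofReal (latticeNorm y ^ 3) < ⊤

/-- Uniform nondegeneracy of one coordinate: there are an index `j` and a constant `κ₀ > 0` with
`P_x{Y_1^j - Y_0^j ≥ 1} ≥ κ₀` for all `x`, or `P_x{Y_1^j - Y_0^j ≤ -1} ≥ κ₀` for all `x`. -/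
def UniformlyNondegenerate {d : ℕ} (q : (Fin d → ℤ) → PMF (Fin d → ℤ)) : Prop :=
  ∃ (j : Fin d) (κ₀ : ℝ), 0 < κ₀ ∧
    ((∀ x, ENNReal.ofReal κ₀ ≤ (q x).toMeasure {y | 1 ≤ y j - x j}) ∨
      (∀ x, ENNReal.ofReal κ₀ ≤ (q x).toMeasure {y | y j - x j ≤ -1}))

/-- Every coordinate that is degenerate for the random walk `Ȳ` is also degenerate for the
chain `Y`. -/
def DegenerateCoordinatesCompatible {d : ℕ} (q qbar : (Fin d → ℤ) → PMF (Fin d → ℤ)) : Prop :=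
  ∀ i : Fin d, (∀ y : Fin d → ℤ, y i ≠ 0 → qbar 0 y = 0) →
    ∀ x y : Fin d → ℤ, x i ≠ y i → q x y = 0

/-- From every common initial state `x`, the one-step transitions `q(x,·)` and `q̄(x,·)` have a
coupling `π` with `P_{x,x}[Y_1 ≠ Ȳ_1] ≤ C e^{-α₁|x|}`, where `C` and `α₁` do not depend
on `x`. -/
def ExponentiallyCoupled {d : ℕ} (q qbar : (Fin d → ℤ) → PMF (Fin d → ℤ)) : Prop :=
  ∃ C α₁ : ℝ, 0 < C ∧ 0 < α₁ ∧ ∀ x, ∃ π : PMF ((Fin d → ℤ) × (Fin d → ℤ)),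
    π.map Prod.fst = q x ∧ π.map Prod.snd = qbar x ∧
      π.toMeasure {p | p.1 ≠ p.2} ≤ ENNReal.ofReal (C * Real.exp (-α₁ * latticeNorm x))

/-! The proof builds a Lyapunov function: for every `M > 0` there is `F` with values in `[0, M]`
such that one step of the chain from `x` raises its mean by at least `c * exp (-lam * |U x|) - K /
M`, where `c` and `K` do not depend on `M` and `U` is a signed coordinate (`exists_lyapunov`).
Summing along the chain telescopes, so the expected sum of the gains over `n` steps is at most `M +
n * K / M`. Since `h` is dominated by a multiple of the gain, `M = √n` gives the bound with `η =
1/2`.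

Before truncation, `F` is a potential `f (U x)`. Far from the origin `f` is made of softplus
functions: they are convex and Lipschitz, so under the symmetric walk their mean increases, by an
amount of order `exp (-lam * |u|)` (`exists_softplus_drift`). The coupling carries this over to the
chain with an error of smaller order (`indicator_compl_estimates`). For `|u| < R` the walk gives no
information; there `f` grows geometrically, so fast that an upward jump of probability `κ` alone
produces the drift (`exists_potential`). Finally `f` is replaced by `M f / (M + f)`, which costs a
second moment divided by `M` (`truncation_step`). -/

/-! ### Convexity of softplus. -/

/-- The softplus function `t ↦ log (1 + e^t)`. -/
noncomputable def softplus (t : ℝ) : ℝ := Real.log (1 + Real.exp t)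

lemma softplus_nonneg (t : ℝ) : 0 ≤ softplus t :=
  Real.log_nonneg (by linarith [Real.exp_pos t])

lemma softplus_mono : Monotone softplus := fun s t hst =>
  Real.log_le_log (by positivity) (by gcongr)

lemma softplus_le_exp_abs (t : ℝ) : softplus t ≤ Real.exp |t| := by
  have h1 : softplus t ≤ Real.exp t := by
    have := Real.log_le_sub_one_of_pos (show 0 < 1 + Real.exp t by positivity)
    unfold softplus; linarith
  exact h1.trans (Real.exp_le_exp.2 (le_abs_self t))

lemma softplus_le_add (s t : ℝ) (hst : t ≤ s) : softplus s ≤ softplus t + (s - t) := by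
  have : softplus t + (s - t) = Real.log ((1 + Real.exp t) * Real.exp (s - t)) := by
    rw [Real.log_mul (by positivity) (by positivity), Real.log_exp, softplus]
  rw [this]
  refine Real.log_le_log (by positivity) ?_
  have h1 : Real.exp t * Real.exp (s - t) = Real.exp s := by rw [← Real.exp_add]; ring_nf
  have h2 : 1 ≤ Real.exp (s - t) := Real.one_le_exp (by linarith)
  nlinarith

lemma abs_softplus_sub_le (s t : ℝ) : |softplus s - softplus t| ≤ |s - t| := by
  rcases le_total t s with h | h
  · rw [abs_of_nonneg (sub_nonneg.2 (softplus_mono h)), abs_of_nonneg (sub_nonneg.2 h)]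
    linarith [softplus_le_add s t h]
  · rw [abs_sub_comm, abs_sub_comm s, abs_of_nonneg (sub_nonneg.2 (softplus_mono h)),
      abs_of_nonneg (sub_nonneg.2 h)]
    linarith [softplus_le_add t s h]

/-- With `a = exp t`, this is the logarithm of `(1 + a e^m)(1 + a e^(-m)) = (1 + a)² + a (e^m +
e^(-m) - 2)`. -/
lemma softplus_add_softplus_sub (t m : ℝ) :
    softplus (t + m) + softplus (t - m) = 2 * softplus t +
      Real.log (1 + Real.exp t * (Real.exp m + Real.exp (-m) - 2) / (1 + Real.exp t) ^ 2) := by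
  have hm : Real.exp m * Real.exp (-m) = 1 := by rw [← Real.exp_add]; simp
  have hm2 : 0 ≤ Real.exp m + Real.exp (-m) - 2 := by
    nlinarith [sq_nonneg (Real.exp m - 1), Real.exp_pos m, Real.exp_pos (-m)]
  have hpos : 0 < 1 + Real.exp t * (Real.exp m + Real.exp (-m) - 2) / (1 + Real.exp t) ^ 2 := by
    positivity
  unfold softplus
  rw [← Real.log_mul (by positivity) (by positivity),
    show 2 * Real.log (1 + Real.exp t) = Real.log ((1 + Real.exp t) ^ 2) by simp [Real.log_pow],
    ← Real.log_mul (by positivity) hpos.ne']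
  congr 1
  rw [Real.exp_add, sub_eq_add_neg, Real.exp_add]
  field_simp
  linear_combination (Real.exp t) ^ 2 * hm

lemma two_mul_softplus_le (t m : ℝ) :
    2 * softplus t ≤ softplus (t + m) + softplus (t - m) := by
  have hm : Real.exp m * Real.exp (-m) = 1 := by rw [← Real.exp_add]; simp
  have hm2 : 0 ≤ Real.exp m + Real.exp (-m) - 2 := by
    nlinarith [sq_nonneg (Real.exp m - 1), Real.exp_pos m, Real.exp_pos (-m)]
  rw [softplus_add_softplus_sub]
  have : 0 ≤ Real.log (1 + Real.exp t * (Real.exp m + Real.exp (-m) - 2) /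
      (1 + Real.exp t) ^ 2) := Real.log_nonneg (le_add_of_nonneg_right (by positivity))
  linarith

/-- The second difference is `log (1 + x)` with `x = a b / (1 + a)²`. Here `x ≥ (b / 4) exp (-|t|)`
because `(1 + a)² ≤ 4 max(1, a²)`, and `log (1 + x) ≥ x / (1 + x)` with `x ≤ b`. -/
lemma exists_softplus_strictly_convex {m : ℝ} (hm0 : m ≠ 0) :
    ∃ c : ℝ, 0 < c ∧ ∀ t,
      2 * softplus t + c * Real.exp (-|t|) ≤ softplus (t + m) + softplus (t - m) := by
  have hm : Real.exp m * Real.exp (-m) = 1 := by rw [← Real.exp_add]; simp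
  set b := Real.exp m + Real.exp (-m) - 2 with hb
  have hb0 : 0 < b := by
    have h1 : Real.exp m ≠ 1 := by simpa using hm0
    have h2 : 0 < (Real.exp m - 1) ^ 2 := by positivity [sub_ne_zero.2 h1]
    have h3 : b * Real.exp m = (Real.exp m - 1) ^ 2 := by rw [hb]; linear_combination hm
    by_contra hcon
    nlinarith [Real.exp_pos m]
  refine ⟨b / 4 / (1 + b), by positivity, fun t => ?_⟩
  rw [softplus_add_softplus_sub, ← hb]
  set a := Real.exp t with ha
  have ha0 : 0 < a := Real.exp_pos t
  set x := a * b / (1 + a) ^ 2 with hx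
  have hx0 : 0 < x := by positivity
  have hxb : x ≤ b := by
    rw [hx, div_le_iff₀ (by positivity)]; nlinarith [mul_pos ha0 hb0, mul_pos (mul_pos ha0 ha0) hb0]
  have hxl : b / 4 * Real.exp (-|t|) ≤ x := by
    rw [hx, le_div_iff₀ (by positivity)]
    rcases le_total 0 t with h | h
    · have h1 : Real.exp (-|t|) * a = 1 := by rw [abs_of_nonneg h, ha, ← Real.exp_add]; simp
      have h2 : 1 ≤ a := Real.one_le_exp h
      have h3 : (1 + a) ^ 2 ≤ 4 * (a * a) := by nlinarith
      calc b / 4 * Real.exp (-|t|) * (1 + a) ^ 2 ≤ b / 4 * Real.exp (-|t|) * (4 * (a * a)) := by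
            gcongr
        _ = b * a * (Real.exp (-|t|) * a) := by ring
        _ = a * b := by rw [h1]; ring
    · have h1 : Real.exp (-|t|) = a := by rw [abs_of_nonpos h, ha, neg_neg]
      have h2 : a ≤ 1 := Real.exp_le_one_iff.2 h
      rw [h1]
      have h3 : (1 + a) ^ 2 ≤ 4 := by nlinarith
      nlinarith [mul_pos ha0 hb0]
  have hlog : x / (1 + x) ≤ Real.log (1 + x) := by
    have := Real.one_sub_inv_le_log_of_pos (show 0 < 1 + x by positivity)
    have h2 : x / (1 + x) = 1 - (1 + x)⁻¹ := by field_simp; ring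
    linarith
  have : b / 4 / (1 + b) * Real.exp (-|t|) ≤ x / (1 + x) := by
    calc b / 4 / (1 + b) * Real.exp (-|t|) = b / 4 * Real.exp (-|t|) / (1 + b) := by ring
      _ ≤ x / (1 + b) := by gcongr
      _ ≤ x / (1 + x) := by gcongr
  linarith

/-! ### The one-dimensional potential. -/

/-- The comparison function that minorizes the potential at points far from the origin. -/
noncomputable def comparison (lam R S : ℝ) (v : ℝ) : ℝ :=
  softplus (lam * v) + S * max (softplus (lam * (v - R + 1)) - softplus 0) 0

lemma comparison_nonneg {lam R S : ℝ} (hS : 0 ≤ S) (v : ℝ) : 0 ≤ comparison lam R S v :=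
  add_nonneg (softplus_nonneg _) (mul_nonneg hS (le_max_right _ _))

lemma comparison_mono {lam R S : ℝ} (hlam : 0 < lam) (hS : 0 ≤ S) :
    Monotone (comparison lam R S) := by
  intro u v huv
  have h1 : softplus (lam * u) ≤ softplus (lam * v) := softplus_mono (by gcongr)
  have h2 : softplus (lam * (u - R + 1)) ≤ softplus (lam * (v - R + 1)) :=
    softplus_mono (by gcongr)
  unfold comparison
  gcongr

lemma comparison_le {lam R S : ℝ} (hlam : 0 < lam) (hR : 1 ≤ R) (hS : 0 ≤ S) (v : ℝ) :
    comparison lam R S v ≤ (1 + S) * Real.exp (lam * |v|) := by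
  have h1 := softplus_le_exp_abs (lam * v)
  rw [abs_mul, abs_of_pos hlam] at h1
  have h2 : max (softplus (lam * (v - R + 1)) - softplus 0) 0 ≤ Real.exp (lam * |v|) := by
    refine max_le ?_ (Real.exp_pos _).le
    have : softplus (lam * (v - R + 1)) ≤ softplus (lam * v) :=
      softplus_mono (by gcongr; linarith)
    linarith [softplus_nonneg 0]
  unfold comparison
  nlinarith

lemma abs_comparison_sub_le {lam R S : ℝ} (hlam : 0 < lam) (hS : 0 ≤ S) (v u : ℝ) :
    |comparison lam R S v - comparison lam R S u| ≤ lam * (1 + S) * |v - u| := by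
  have h1 := abs_softplus_sub_le (lam * v) (lam * u)
  have h2 := abs_softplus_sub_le (lam * (v - R + 1)) (lam * (u - R + 1))
  rw [show lam * v - lam * u = lam * (v - u) by ring, abs_mul, abs_of_pos hlam] at h1
  rw [show lam * (v - R + 1) - lam * (u - R + 1) = lam * (v - u) by ring, abs_mul,
    abs_of_pos hlam] at h2
  have h3 := abs_max_sub_max_le_abs (softplus (lam * (v - R + 1)) - softplus 0)
    (softplus (lam * (u - R + 1)) - softplus 0) 0
  rw [sub_sub_sub_cancel_right] at h3
  have h4 := mul_le_mul_of_nonneg_left (h3.trans h2) hS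
  rw [← abs_of_nonneg hS, ← abs_mul, abs_of_nonneg hS] at h4
  calc _ = |(softplus (lam * v) - softplus (lam * u)) +
        S * (max (softplus (lam * (v - R + 1)) - softplus 0) 0 -
          max (softplus (lam * (u - R + 1)) - softplus 0) 0)| := by
        unfold comparison; ring_nf
    _ ≤ _ := abs_add_le _ _
    _ ≤ _ := by linarith

/-- A potential on `ℤ` that agrees with comparison functions outside `(-R, R)` and grows
geometrically inside. -/
lemma exists_potential {lam c κ : ℝ} (hlam : 0 < lam) (hc : 0 < c) (hκ : 0 < κ) (hκ1 : κ ≤ 1)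
    (R : ℕ)
    (hR : 1 ≤ R) :
    ∃ (f : ℤ → ℝ) (S K : ℝ), 0 ≤ S ∧ 0 ≤ K ∧ Monotone f ∧
      (∀ u : ℤ, comparison lam R 0 u ≤ f u) ∧ (∀ u : ℤ, comparison lam R S u ≤ f u) ∧
      (∀ u : ℤ, u ≤ -R → f u = comparison lam R 0 u) ∧
      (∀ u : ℤ, R ≤ u → f u = comparison lam R S u) ∧
      (∀ u : ℤ, -R < u → u < R → f u + c ≤ κ * f (u + 1)) ∧
      (∀ u, f u ≤ K * Real.exp (lam * |(u : ℝ)|)) := by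
  have hR' : (1 : ℝ) ≤ R := by exact_mod_cast hR
  -- With `κ * B = 2 + κ`, the geometric term at `u + 1` times `κ` is at least twice the one at `u`;
  -- the second copy is at least `D`, which absorbs `softplus (lam * u) + c`.
  set B : ℝ := 2 / κ + 1 with hB
  have hB0 : 0 < B := by positivity
  set D : ℝ := softplus (lam * R) + c with hD
  have hD0 : 0 < D := by have := softplus_nonneg (lam * R); positivity
  have hw : 0 < softplus lam - softplus 0 := by
    refine sub_pos.2 (Real.log_lt_log (by positivity) ?_)
    gcongr
  -- Makes the second term of the comparison function at `R` equal to `D * B ^ (2 * R)`, the value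
  -- that continues the geometric growth.
  set S : ℝ := D * B ^ (2 * R) / (softplus lam - softplus 0) with hS
  have hS0 : 0 ≤ S := by positivity
  have hSw : S * (softplus lam - softplus 0) = D * B ^ (2 * R) := by
    rw [hS]; field_simp
  set f : ℤ → ℝ := fun u =>
    if R ≤ u then comparison lam R S u
    else if u ≤ -R then comparison lam R 0 u
    else softplus (lam * u) + D * B ^ (u + R) with hf
  -- The shift by `R - 1` makes the second term vanish at every integer below `R` and already be
  -- positive at `R`.
  have hcomp : ∀ u : ℤ, u < R → comparison lam R S u = comparison lam R 0 u := by
    intro u hu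
    have h1 : (u : ℝ) + 1 ≤ R := by exact_mod_cast hu
    have h2 : softplus (lam * (u - R + 1)) ≤ softplus 0 :=
      softplus_mono (mul_nonpos_of_nonneg_of_nonpos hlam.le (by linarith))
    simp [comparison, h2]
  have hle : ∀ u : ℤ, comparison lam R S u ≤ f u := by
    intro u
    simp only [hf]
    split_ifs with h1 h2
    · exact le_rfl
    · exact (hcomp u (by omega)).le
    · rw [hcomp u (by omega)]
      simp only [comparison, zero_mul, add_zero]
      have : 0 < D * B ^ (u + R) := by positivity
      linarith
  have hle0 : ∀ u : ℤ, comparison lam R 0 u ≤ comparison lam R S u := by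
    intro u
    unfold comparison
    have := mul_nonneg hS0 (le_max_right (softplus (lam * (u - R + 1)) - softplus 0) 0)
    linarith
  have hmidB : ∀ u : ℤ, u < R → -R < u → D * B ^ (u + R) ≤ ∑ k ∈ Finset.range (2 * R + 1), D * B ^ k := by
    intro u h1 h2
    obtain ⟨k, hk⟩ := Int.eq_ofNat_of_zero_le (show 0 ≤ u + R by omega)
    rw [hk, zpow_natCast]
    exact Finset.single_le_sum (f := fun k => D * B ^ k) (fun i _ => by positivity)
      (Finset.mem_range.2 (by omega))
  have hleft : ∀ u : ℤ, u ≤ -R → f u = comparison lam R 0 u := by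
    intro u hu
    simp only [hf]
    rw [if_neg (by omega), if_pos hu]
  have hright : ∀ u : ℤ, R ≤ u → f u = comparison lam R S u := by
    intro u hu
    simp only [hf]
    rw [if_pos hu]
  have hmid : ∀ u : ℤ, -R < u → u < R → f u + c ≤ κ * f (u + 1) := by
    intro u h1 h2
    have hu : f u = softplus (lam * u) + D * B ^ (u + R) := by
      simp only [hf]
      rw [if_neg (by omega), if_neg (by omega)]
    have hB1 : 1 ≤ B := by rw [hB]; linarith [show 0 < 2 / κ by positivity]
    have hpow : 1 ≤ B ^ (u + R) := one_le_zpow₀ hB1 (by omega)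
    have hκB : κ * B = 2 + κ := by rw [hB]; field_simp
    have huD : softplus (lam * u) + c ≤ D := by
      have : (u : ℝ) ≤ R := by exact_mod_cast h2.le
      have := softplus_mono (mul_le_mul_of_nonneg_left this hlam.le)
      linarith
    have hstep : κ * (D * B ^ (u + 1 + R)) = (2 + κ) * (D * B ^ (u + R)) := by
      rw [show u + 1 + R = (u + R) + 1 by ring, zpow_add_one₀ hB0.ne', ← hκB]; ring
    have hDB : D ≤ D * B ^ (u + R) := le_mul_of_one_le_right hD0.le hpow
    have hu1 : D * B ^ (u + 1 + R) ≤ f (u + 1) := by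
      simp only [hf]
      split_ifs with h3 h4
      · have h5 : u + 1 = R := by omega
        rw [h5]
        have : comparison lam R S ((R : ℤ) : ℝ) = softplus (lam * R) + D * B ^ (2 * R) := by
          rw [← hSw]
          simp only [comparison, Int.cast_natCast, sub_self, zero_add, mul_one]
          rw [max_eq_left hw.le]
        rw [this, show ((R : ℤ) + R) = ((2 * R : ℕ) : ℤ) by push_cast; ring, zpow_natCast]
        linarith [softplus_nonneg (lam * R)]
      · omega
      · linarith [softplus_nonneg (lam * (u + 1 : ℤ))]
    have h6 := mul_le_mul_of_nonneg_left hu1 hκ.le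
    have h7 : 0 ≤ κ * (D * B ^ (u + R)) := by positivity
    linarith
  have hmono : Monotone f := by
    refine monotone_int_of_le_succ fun u => ?_
    rcases le_or_gt u (-R) with h1 | h1
    · rw [hleft u h1]
      refine le_trans (comparison_mono hlam le_rfl ?_) ((hle0 _).trans (hle _))
      push_cast; linarith
    · rcases lt_or_ge u R with h2 | h2
      · have h3 : 0 ≤ f (u + 1) := (comparison_nonneg hS0 _).trans (hle _)
        nlinarith [hmid u h1 h2]
      · rw [hright u h2, hright (u + 1) (by omega)]
        refine comparison_mono hlam hS0 ?_
        push_cast; linarith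
  refine ⟨f, S, 1 + S + ∑ k ∈ Finset.range (2 * R + 1), D * B ^ k, hS0, by positivity, hmono,
    fun u => (hle0 u).trans (hle u), hle, hleft, hright, hmid, fun u => ?_⟩
  have he : 1 ≤ Real.exp (lam * |(u : ℝ)|) := Real.one_le_exp (by positivity)
  have hT : 0 ≤ ∑ k ∈ Finset.range (2 * R + 1), D * B ^ k := by positivity
  have hc0 := comparison_le hlam hR' le_rfl (u : ℝ)
  have hcS := comparison_le hlam hR' hS0 (u : ℝ)
  simp only [hf]
  split_ifs with h1 h2
  · nlinarith
  · nlinarith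
  · have h3 := hmidB u (by omega) (by omega)
    simp only [comparison, zero_mul, add_zero] at hc0
    nlinarith

/-! ### Truncation of the potential. -/

/-- Second-order expansion of `φ z = M z / (M + z)` at `a`: the remainder is at most `(z - a)² / M`.
Moments are needed only for the minorant `Z`; `V` itself enters through the bounded `φ V`. -/
lemma truncation_step {Ω : Type*} [MeasurableSpace Ω] {P : Measure Ω} [IsProbabilityMeasure P]
    {Z V : Ω → ℝ} {a h K M : ℝ} (hZ : Integrable Z P) (hZ2 : Integrable (fun ω => (Z ω - a) ^ 2) P)
    (hV : Measurable V) (hZ0 : ∀ ω, 0 ≤ Z ω) (hZV : ∀ ω, Z ω ≤ V ω) (ha : 0 ≤ a) (hh : 0 ≤ h)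
    (hEZ : a + h ≤ ∫ ω, Z ω ∂P) (hK : ∫ ω, (Z ω - a) ^ 2 ∂P ≤ K) (hM : 0 < M) :
    M * a / (M + a) + h - (2 * a * h + K) / M ≤ ∫ ω, M * V ω / (M + V ω) ∂P := by
  -- The derivative of `φ` at `a`.
  set θ : ℝ := M ^ 2 / (M + a) ^ 2 with hθ
  have hθ0 : 0 ≤ θ := by positivity
  have hθ1 : 1 - 2 * a / M ≤ θ := by
    rw [hθ, le_div_iff₀ (by positivity), sub_mul, div_mul_eq_mul_div, one_mul, sub_le_iff_le_add,
      ← sub_le_iff_le_add', le_div_iff₀ hM]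
    nlinarith [mul_nonneg ha hM.le, pow_pos hM 2, mul_nonneg (mul_nonneg ha ha) hM.le,
      mul_nonneg (mul_nonneg ha ha) ha]
  have hpt : ∀ ω, M * a / (M + a) + θ * (Z ω - a) - (Z ω - a) ^ 2 / M ≤ M * V ω / (M + V ω) := by
    intro ω
    have hz := hZ0 ω
    have hv : 0 ≤ V ω := hz.trans (hZV ω)
    have h1 : M * Z ω / (M + Z ω) ≤ M * V ω / (M + V ω) := by
      rw [div_le_div_iff₀ (by positivity) (by positivity)]
      nlinarith [mul_le_mul_of_nonneg_left (hZV ω) (sq_nonneg M)]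
    have h2 : M * Z ω / (M + Z ω) = M * a / (M + a) + θ * (Z ω - a) -
        (Z ω - a) ^ 2 * (θ / (M + Z ω)) := by
      rw [hθ]; field_simp; ring
    have h3 : θ / (M + Z ω) ≤ 1 / M := by
      have : θ ≤ 1 := by
        rw [hθ, div_le_one (by positivity)]; gcongr; linarith
      gcongr
      linarith
    have h4 := mul_le_mul_of_nonneg_left h3 (sq_nonneg (Z ω - a))
    rw [mul_one_div] at h4
    linarith
  have hintZ : Integrable (fun ω => θ * (Z ω - a)) P := (hZ.sub (integrable_const a)).const_mul θ
  have hint1 : Integrable (fun ω => M * a / (M + a) + θ * (Z ω - a)) P :=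
    (integrable_const _).add hintZ
  have hintV : Integrable (fun ω => M * V ω / (M + V ω)) P := by
    refine Integrable.of_bound (C := M) ?_ (Filter.Eventually.of_forall fun ω => ?_)
    · exact ((hV.const_mul M).div (hV.const_add M)).aestronglyMeasurable
    · have hv : 0 ≤ V ω := (hZ0 ω).trans (hZV ω)
      rw [Real.norm_of_nonneg (by positivity), div_le_iff₀ (by positivity)]
      nlinarith
  have hmono := integral_mono (hint1.sub (hZ2.div_const M)) hintV hpt
  simp only [Pi.sub_apply] at hmono
  rw [integral_sub hint1 (hZ2.div_const M), integral_add (integrable_const _) hintZ, integral_const_mul,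
    integral_sub hZ (integrable_const _)] at hmono
  simp only [integral_const, probReal_univ, one_smul] at hmono
  have h5 : θ * h ≤ θ * (∫ ω, Z ω ∂P - a) := by gcongr; linarith
  have h6 : (1 - 2 * a / M) * h ≤ θ * h := by gcongr
  have h7 : ∫ ω, (Z ω - a) ^ 2 / M ∂P ≤ K / M := by rw [integral_div]; gcongr
  have h8 : (2 * a * h + K) / M = 2 * a / M * h + K / M := by ring
  rw [h8]
  linarith

/-! ### Moments and softplus drift of the symmetric walk. -/

variable {d : ℕ}

lemma IsSymmetricRandomWalk.apply_neg {qbar : (Fin d → ℤ) → PMF (Fin d → ℤ)}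
    (hw : IsSymmetricRandomWalk qbar) (v : Fin d → ℤ) : qbar 0 (-v) = qbar 0 v := by
  rw [(hw 0 (-v)).1, (hw (-v) 0).2, zero_sub, neg_neg]

lemma IsSymmetricRandomWalk.map_reflect {qbar : (Fin d → ℤ) → PMF (Fin d → ℤ)}
    (hw : IsSymmetricRandomWalk qbar) (x : Fin d → ℤ) :
    (qbar x).toMeasure.map (fun y => x + x - y) = (qbar x).toMeasure := by
  refine Measure.ext_of_singleton fun b => ?_
  rw [Measure.map_apply (measurable_of_countable _) (measurableSet_singleton _),
    show (fun y => x + x - y) ⁻¹' {b} = {x + x - b} by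
      ext y; simp only [Set.mem_preimage, Set.mem_singleton_iff]
      constructor <;> rintro rfl <;> abel,
    PMF.toMeasure_apply_singleton _ _ (measurableSet_singleton _),
    PMF.toMeasure_apply_singleton _ _ (measurableSet_singleton _), (hw x _).2, (hw x b).2,
    ← hw.apply_neg]
  congr 1; abel

lemma IsSymmetricRandomWalk.map_translate {qbar : (Fin d → ℤ) → PMF (Fin d → ℤ)}
    (hw : IsSymmetricRandomWalk qbar) (x : Fin d → ℤ) :
    (qbar 0).toMeasure.map (fun y => x + y) = (qbar x).toMeasure := by
  refine Measure.ext_of_singleton fun b => ?_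
  rw [Measure.map_apply (measurable_of_countable _) (measurableSet_singleton _),
    show (fun y => x + y) ⁻¹' {b} = {b - x} by
      ext y; simp only [Set.mem_preimage, Set.mem_singleton_iff]
      constructor <;> rintro rfl <;> abel,
    PMF.toMeasure_apply_singleton _ _ (measurableSet_singleton _),
    PMF.toMeasure_apply_singleton _ _ (measurableSet_singleton _), (hw x b).2]

lemma exists_second_moment_bound {qbar : (Fin d → ℤ) → PMF (Fin d → ℤ)}
    (hw : IsSymmetricRandomWalk qbar) (hm : HasThirdMoment qbar) (U : (Fin d → ℤ) →+ ℤ)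
    (hU : ∀ x, |(U x : ℝ)| ≤ latticeNorm x) :
    ∃ K : ℝ, 0 ≤ K ∧ ∀ x, Integrable (fun y => ((U y : ℝ) - U x) ^ 2) (qbar x).toMeasure ∧
      ∫ y, ((U y : ℝ) - U x) ^ 2 ∂(qbar x).toMeasure ≤ K := by
  have h3 : Integrable (fun y => latticeNorm y ^ 3) (qbar 0).toMeasure := by
    refine ⟨(measurable_of_countable _).aestronglyMeasurable, ?_⟩
    rw [HasFiniteIntegral, lintegral_countable']
    refine lt_of_le_of_lt (ENNReal.tsum_le_tsum fun y => le_of_eq ?_) hm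
    have h0 : 0 ≤ latticeNorm y := norm_nonneg _
    rw [PMF.toMeasure_apply_singleton _ _ (measurableSet_singleton _), mul_comm,
      Real.enorm_of_nonneg (pow_nonneg h0 3)]
  have h2 : Integrable (fun y => (U y : ℝ) ^ 2) (qbar 0).toMeasure := by
    refine ((integrable_const (1 : ℝ)).add h3).mono'
      (measurable_of_countable _).aestronglyMeasurable (Filter.Eventually.of_forall fun y => ?_)
    have h0 : 0 ≤ latticeNorm y := norm_nonneg _
    have h4 : (U y : ℝ) ^ 2 ≤ latticeNorm y ^ 2 := by
      rw [← sq_abs]; gcongr; exact hU y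
    rw [Real.norm_of_nonneg (by positivity), Pi.add_apply]
    rcases le_total (latticeNorm y) 1 with h5 | h5
    · have := pow_le_one₀ (n := 2) h0 h5
      have := pow_nonneg h0 3
      linarith
    · have := pow_le_pow_right₀ h5 (show 2 ≤ 3 by norm_num)
      linarith
  refine ⟨∫ y, (U y : ℝ) ^ 2 ∂(qbar 0).toMeasure, by positivity, fun x => ?_⟩
  rw [← hw.map_translate x, integral_map (measurable_of_countable _).aemeasurable
    (measurable_of_countable _).aestronglyMeasurable,
    integrable_map_measure (measurable_of_countable _).aestronglyMeasurable
    (measurable_of_countable _).aemeasurable]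
  simp only [map_add, Int.cast_add, add_sub_cancel_left, Function.comp_def]
  exact ⟨h2, le_rfl⟩

lemma integrable_of_lipschitz {Ω : Type*} [MeasurableSpace Ω] {P : Measure Ω}
    [IsProbabilityMeasure P] {X G : Ω → ℝ} {u b L : ℝ}
    (hX : Integrable (fun ω => (X ω - u) ^ 2) P) (hG : AEStronglyMeasurable G P) (hL : 0 ≤ L)
    (h : ∀ ω, |G ω - b| ≤ L * |X ω - u|) : Integrable G P := by
  refine ((integrable_const (|b| + L)).add (hX.const_mul L)).mono' hG
    (Filter.Eventually.of_forall fun ω => ?_)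
  have h1 : |X ω - u| ≤ 1 + (X ω - u) ^ 2 := by
    rw [← sq_abs]; nlinarith [sq_nonneg (|X ω - u| - 1)]
  have h2 := mul_le_mul_of_nonneg_left h1 hL
  have h3 : |G ω| ≤ |b| + |G ω - b| := by
    have := abs_add_le b (G ω - b); rwa [add_sub_cancel] at this
  rw [Real.norm_eq_abs, Pi.add_apply]
  linarith [h ω]

/-- Averaging over `y` and its reflection `2x - y` turns convexity into a submartingale inequality.
Strict convexity is used only at the atom `y = x + e`, whence the factor `qbar 0 e / 2`; the
constant is uniform in the shift `b`. -/
lemma exists_softplus_drift {qbar : (Fin d → ℤ) → PMF (Fin d → ℤ)}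
    (hw : IsSymmetricRandomWalk qbar) (U : (Fin d → ℤ) →+ ℤ)
    (h2 : ∀ x, Integrable (fun y => ((U y : ℝ) - U x) ^ 2) (qbar x).toMeasure)
    {e : Fin d → ℤ} (he : qbar 0 e ≠ 0) (hUe : U e ≠ 0) {lam : ℝ} (hlam : 0 < lam) :
    ∃ c : ℝ, 0 < c ∧ ∀ (b : ℝ) (x : Fin d → ℤ),
      Integrable (fun y => softplus (lam * U y + b)) (qbar x).toMeasure ∧
      softplus (lam * U x + b) + c * Real.exp (-|lam * U x + b|) ≤
        ∫ y, softplus (lam * U y + b) ∂(qbar x).toMeasure := by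
  obtain ⟨c, hc, hconv⟩ := exists_softplus_strictly_convex (m := lam * (U e : ℝ))
    (mul_ne_zero hlam.ne' (by exact_mod_cast hUe))
  have hρ : 0 < (qbar 0 e).toReal := ENNReal.toReal_pos he (PMF.apply_ne_top _ _)
  refine ⟨c * (qbar 0 e).toReal / 2, by positivity, fun b x => ?_⟩
  have hint : Integrable (fun y => softplus (lam * U y + b)) (qbar x).toMeasure := by
    refine integrable_of_lipschitz (b := softplus (lam * U x + b)) (L := lam) (h2 x)
      (measurable_of_countable _).aestronglyMeasurable hlam.le fun y => ?_
    refine (abs_softplus_sub_le _ _).trans (le_of_eq ?_)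
    rw [add_sub_add_right_eq_sub, ← mul_sub, abs_mul, abs_of_pos hlam]
  refine ⟨hint, ?_⟩
  have hmap := hw.map_reflect x
  have hint' : Integrable (fun y => softplus (lam * U (x + x - y) + b)) (qbar x).toMeasure := by
    have h := hint
    rw [← hmap] at h
    exact h.comp_measurable (measurable_of_countable _)
  have heq : ∫ y, softplus (lam * U (x + x - y) + b) ∂(qbar x).toMeasure =
      ∫ y, softplus (lam * U y + b) ∂(qbar x).toMeasure := by
    conv_rhs => rw [← hmap]
    rw [integral_map (measurable_of_countable _).aemeasurable
      (measurable_of_countable _).aestronglyMeasurable]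
  set t := lam * U x + b with ht
  have hind : Integrable (({x + e} : Set (Fin d → ℤ)).indicator fun _ => c * Real.exp (-|t|))
      (qbar x).toMeasure :=
    (integrable_const _).indicator (measurableSet_singleton _)
  have hpt : ∀ y, 2 * softplus t +
      ({x + e} : Set (Fin d → ℤ)).indicator (fun _ => c * Real.exp (-|t|)) y ≤
      softplus (lam * U y + b) + softplus (lam * U (x + x - y) + b) := by
    intro y
    have h3 : lam * (U y : ℝ) + b = t + lam * (U y - U x) := by rw [ht]; ring
    have h4 : lam * (U (x + x - y) : ℝ) + b = t - lam * (U y - U x) := by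
      rw [ht]; simp only [map_sub, map_add, Int.cast_sub, Int.cast_add]; ring
    rw [h3, h4]
    by_cases hy : y ∈ ({x + e} : Set (Fin d → ℤ))
    · rw [Set.indicator_of_mem hy]
      have h5 : (U y : ℝ) - U x = U e := by
        rw [Set.mem_singleton_iff.1 hy]; simp
      rw [h5]
      exact hconv t
    · rw [Set.indicator_of_notMem hy, add_zero]
      exact two_mul_softplus_le _ _
  have hmono := integral_mono ((integrable_const (2 * softplus t)).add hind) (hint.add hint') hpt
  simp only [Pi.add_apply] at hmono
  rw [integral_add (integrable_const _) hind, integral_add hint hint', heq,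
    integral_indicator (measurableSet_singleton _)] at hmono
  simp only [integral_const, probReal_univ, measureReal_restrict_apply_univ,
    smul_eq_mul] at hmono
  rw [measureReal_def, PMF.toMeasure_apply_singleton _ _ (measurableSet_singleton _),
    (hw x _).2, add_sub_cancel_left] at hmono
  linarith

/-! ### Error from failed coupling, and drift of the comparison function. -/

/-- Controls the loss when the value is replaced by `0` on a bad event of probability at most `r²`:
the Lipschitz bound reduces it to the mean of `|X - u|` on `A`, which is of order `r`. -/
lemma indicator_compl_estimates {Ω : Type*} [MeasurableSpace Ω] {P : Measure Ω}
    [IsProbabilityMeasure P] {X : Ω → ℝ} {g : ℝ → ℝ} {A : Set Ω} {u L K r : ℝ}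
    (hXm : Measurable X) (hX : Integrable (fun ω => (X ω - u) ^ 2) P)
    (hXK : ∫ ω, (X ω - u) ^ 2 ∂P ≤ K) (hA : MeasurableSet A) (hr : 0 < r)
    (hPA : P.real A ≤ r ^ 2) (hg0 : ∀ v, 0 ≤ g v) (hgm : Measurable g) (hL : 0 ≤ L)
    (hg : ∀ v, |g v - g u| ≤ L * |v - u|) :
    Integrable (Aᶜ.indicator (g ∘ X)) P ∧
      Integrable (fun ω => (Aᶜ.indicator (g ∘ X) ω - g u) ^ 2) P ∧
      ∫ ω, (Aᶜ.indicator (g ∘ X) ω - g u) ^ 2 ∂P ≤ L ^ 2 * K + g u ^ 2 * r ^ 2 ∧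
      ∫ ω, g (X ω) ∂P - (g u * r ^ 2 + L * r * (K + 1)) ≤ ∫ ω, Aᶜ.indicator (g ∘ X) ω ∂P := by
  have hgX : Integrable (g ∘ X) P :=
    integrable_of_lipschitz hX (hgm.comp hXm).aestronglyMeasurable hL fun ω => hg (X ω)
  have hZ : Integrable (Aᶜ.indicator (g ∘ X)) P := hgX.indicator hA.compl
  have hone : Integrable (A.indicator fun _ => (1 : ℝ)) P := (integrable_const _).indicator hA
  have hint_one : ∫ ω, A.indicator (fun _ => (1 : ℝ)) ω ∂P = P.real A := by
    rw [integral_indicator hA]; simp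
  have hsq : ∀ ω, (Aᶜ.indicator (g ∘ X) ω - g u) ^ 2 ≤
      L ^ 2 * (X ω - u) ^ 2 + g u ^ 2 * A.indicator (fun _ => (1 : ℝ)) ω := by
    intro ω
    by_cases hω : ω ∈ A
    · rw [Set.indicator_of_notMem (by simpa using hω), Set.indicator_of_mem hω]
      nlinarith [mul_nonneg (sq_nonneg L) (sq_nonneg (X ω - u))]
    · rw [Set.indicator_of_mem (by simpa using hω), Set.indicator_of_notMem hω,
        Function.comp_apply, ← sq_abs, ← sq_abs (X ω - u), ← mul_pow, mul_zero, add_zero]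
      gcongr
      exact hg _
  have hdom := (hX.const_mul (L ^ 2)).add (hone.const_mul (g u ^ 2))
  have hZ2 : Integrable (fun ω => (Aᶜ.indicator (g ∘ X) ω - g u) ^ 2) P := by
    refine hdom.mono' ((hZ.aestronglyMeasurable.sub aestronglyMeasurable_const).pow 2)
      (Filter.Eventually.of_forall fun ω => ?_)
    rw [Real.norm_of_nonneg (sq_nonneg _)]
    exact hsq ω
  refine ⟨hZ, hZ2, ?_, ?_⟩
  · refine (integral_mono hZ2 hdom hsq).trans ?_
    simp only [Pi.add_apply]
    rw [integral_add (hX.const_mul (L ^ 2)) (hone.const_mul (g u ^ 2)), integral_const_mul,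
      integral_const_mul, hint_one]
    gcongr
  · have hpt : ∀ ω, g (X ω) ≤ Aᶜ.indicator (g ∘ X) ω + ((L * r) * (X ω - u) ^ 2 +
        (g u + L / r) * A.indicator (fun _ => (1 : ℝ)) ω) := by
      intro ω
      by_cases hω : ω ∈ A
      · rw [Set.indicator_of_notMem (by simpa using hω), Set.indicator_of_mem hω]
        -- Weighted AM-GM, in place of Cauchy–Schwarz; the weight `r` balances the two terms since
        -- `P.real A ≤ r ^ 2`.
        have h1 : |X ω - u| ≤ r * (X ω - u) ^ 2 + 1 / r := by
          rw [← sq_abs, ← sub_le_iff_le_add', le_div_iff₀ hr]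
          nlinarith [sq_nonneg (r * |X ω - u| - 1), mul_nonneg hr.le (abs_nonneg (X ω - u))]
        have h2 := mul_le_mul_of_nonneg_left h1 hL
        have h3 := (le_abs_self _).trans (hg (X ω))
        have h4 : L * (r * (X ω - u) ^ 2 + 1 / r) = L * r * (X ω - u) ^ 2 + L / r := by ring
        linarith
      · rw [Set.indicator_of_mem (by simpa using hω), Set.indicator_of_notMem hω,
          Function.comp_apply]
        have : 0 ≤ L * r * (X ω - u) ^ 2 := by positivity
        linarith
    have hi1 := hX.const_mul (L * r)
    have hi2 := hone.const_mul (g u + L / r)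
    have hi3 : Integrable (fun ω => (L * r) * (X ω - u) ^ 2 +
        (g u + L / r) * A.indicator (fun _ => (1 : ℝ)) ω) P := hi1.add hi2
    have h := integral_mono hgX (hZ.add hi3) hpt
    simp only [Pi.add_apply, Function.comp_apply] at h
    rw [integral_add hZ hi3, integral_add hi1 hi2, integral_const_mul, integral_const_mul, hint_one] at h
    have h5 : L * r * ∫ ω, (X ω - u) ^ 2 ∂P ≤ L * r * K := by gcongr
    have h6 : (g u + L / r) * P.real A ≤ (g u + L / r) * r ^ 2 := by
      have := hg0 u
      gcongr
    have h7 : (g u + L / r) * r ^ 2 = g u * r ^ 2 + L * r := by field_simp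
    linarith

/-- For `u ≥ R` the maximum is attained by its first argument at `u`, and discarding the `0`
elsewhere only lowers the mean. Both softplus terms then contribute, so the gain carries the factor
`1 + S`, the same factor as in the Lipschitz constant. -/
lemma le_integral_comparison {P : Measure (Fin d → ℤ)} {U : (Fin d → ℤ) →+ ℤ}
    {u : ℤ} {lam c S R : ℝ} (hlam : 0 < lam) (hc : 0 ≤ c) (hS : 0 ≤ S) (hR : 1 ≤ R)
    (hSR : S = 0 ∨ R ≤ u)
    (hP : ∀ b : ℝ, Integrable (fun y => softplus (lam * U y + b)) P ∧
      softplus (lam * u + b) + c * Real.exp (-|lam * u + b|) ≤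
        ∫ y, softplus (lam * U y + b) ∂P) [IsProbabilityMeasure P] :
    comparison lam R S u + (1 + S) * (c * Real.exp (-(lam * |(u : ℝ)|))) ≤
      ∫ y, comparison lam R S (U y) ∂P := by
  obtain ⟨hi1, h1⟩ := hP 0
  obtain ⟨hi2, h2⟩ := hP (-lam * (R - 1))
  simp only [add_zero] at hi1 h1
  rw [abs_mul, abs_of_pos hlam] at h1
  have hshift : ∀ v : ℝ, lam * v + -lam * (R - 1) = lam * (v - R + 1) := fun v => by ring
  simp only [hshift] at hi2 h2
  rcases hSR with rfl | hRu
  · simpa [comparison] using h1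
  · have hpos : 0 ≤ lam * (u - R + 1) := mul_nonneg hlam.le (by linarith)
    have hu0 : (0 : ℝ) ≤ u := by linarith
    have hexp : Real.exp (-(lam * |(u : ℝ)|)) ≤ Real.exp (-|lam * (u - R + 1)|) := by
      rw [abs_of_nonneg hpos, abs_of_nonneg hu0]
      gcongr
      linarith
    have hlow : ∀ y, softplus (lam * U y) + S * (softplus (lam * (U y - R + 1)) - softplus 0) ≤
        comparison lam R S (U y) := fun y => by
      unfold comparison; gcongr; exact le_max_left _ _
    have hcu : comparison lam R S u = softplus (lam * u) +
        S * (softplus (lam * (u - R + 1)) - softplus 0) := by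
      rw [comparison, max_eq_left (sub_nonneg.2 (softplus_mono hpos))]
    have hi3 : Integrable (fun y => S * (softplus (lam * (U y - R + 1)) - softplus 0)) P :=
      (hi2.sub (integrable_const _)).const_mul S
    have hi4 : Integrable (fun y => comparison lam R S (U y)) P := by
      have : Integrable (fun y => max (softplus (lam * (U y - R + 1)) - softplus 0) 0) P :=
        (hi2.sub (integrable_const _)).pos_part
      exact hi1.add (this.const_mul S)
    have h3 := integral_mono (hi1.add hi3) hi4 hlow
    simp only [Pi.add_apply] at h3
    rw [integral_add hi1 hi3, integral_const_mul, integral_sub hi2 (integrable_const _)] at h3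
    simp only [integral_const, probReal_univ, one_smul] at h3
    rw [hcu]
    have h4 : S * (softplus (lam * (u - R + 1)) + c * Real.exp (-(lam * |(u : ℝ)|))) ≤
        S * ∫ y, softplus (lam * (U y - R + 1)) ∂P := by
      gcongr
      refine le_trans ?_ h2
      gcongr
    linarith

/-! ### The Lyapunov function. -/

lemma exists_lyapunov {q qbar : (Fin d → ℤ) → PMF (Fin d → ℤ)}
    (hw : IsSymmetricRandomWalk qbar) (hm : HasThirdMoment qbar) (U : (Fin d → ℤ) →+ ℤ)
    (hU : ∀ x, |(U x : ℝ)| ≤ latticeNorm x) {κ : ℝ} (hκ : 0 < κ)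
    (hup : ∀ x, ENNReal.ofReal κ ≤ (q x).toMeasure {y | U x + 1 ≤ U y})
    {e : Fin d → ℤ} (he : qbar 0 e ≠ 0) (hUe : U e ≠ 0) {C α lam : ℝ} (hC : 0 < C)
    (hlam : 0 < lam) (hlamα : 4 * lam ≤ α)
    (hcoup : ∀ x, ∃ π : PMF ((Fin d → ℤ) × (Fin d → ℤ)),
      π.map Prod.fst = q x ∧ π.map Prod.snd = qbar x ∧
        π.toMeasure {p | p.1 ≠ p.2} ≤ ENNReal.ofReal (C * Real.exp (-α * latticeNorm x))) :
    ∃ c K : ℝ, 0 < c ∧ 0 ≤ K ∧ ∀ M : ℝ, 0 < M → ∃ F : (Fin d → ℤ) → ℝ,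
      (∀ x, 0 ≤ F x ∧ F x ≤ M) ∧
      ∀ x, F x + c * Real.exp (-(lam * |(U x : ℝ)|)) - K / M ≤ ∫ y, F y ∂(q x).toMeasure := by
  obtain ⟨K2, hK2, h2⟩ := exists_second_moment_bound hw hm U hU
  obtain ⟨c, hc, hdrift⟩ := exists_softplus_drift hw U (fun x => (h2 x).1) he hUe hlam
  set C0 : ℝ := Real.sqrt C with hC0
  have hC0p : 0 < C0 := Real.sqrt_pos.2 hC
  have hC0sq : C0 ^ 2 = C := Real.sq_sqrt hC.le
  have hκ1 : κ ≤ 1 := by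
    have := (hup 0).trans prob_le_one
    exact ENNReal.ofReal_le_one.1 this
  -- `R` must be fixed before `S`, which depends on it. This is possible because gain and coupling
  -- error both scale with `1 + S`.
  obtain ⟨R, hR1, hR⟩ : ∃ R : ℕ, 1 ≤ R ∧
      (C0 ^ 2 + lam * (K2 + 1) * C0) * Real.exp (-(lam * R)) ≤ c / 2 := by
    have ht : Filter.Tendsto (fun R : ℕ => (C0 ^ 2 + lam * (K2 + 1) * C0) *
        Real.exp (-(lam * R))) Filter.atTop (nhds ((C0 ^ 2 + lam * (K2 + 1) * C0) * 0)) := by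
      refine Filter.Tendsto.const_mul _ (Real.tendsto_exp_neg_atTop_nhds_zero.comp ?_)
      exact Filter.Tendsto.const_mul_atTop hlam tendsto_natCast_atTop_atTop
    rw [mul_zero] at ht
    have h1 := ht.eventually (eventually_le_nhds (show 0 < c / 2 by positivity))
    obtain ⟨R, hR1, hR2⟩ := (h1.and (Filter.eventually_ge_atTop 1)).exists
    exact ⟨R, hR2, hR1⟩
  have hR1' : (1 : ℝ) ≤ R := by exact_mod_cast hR1
  obtain ⟨f, S, Kf, hS, hKf, hmono, hf0, hfS, hleft, hright, hmid, hfK⟩ :=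
    exists_potential hlam hc hκ hκ1 R hR1
  have hfnn : ∀ u, 0 ≤ f u := fun u => (comparison_nonneg hS _).trans (hfS u)
  set K : ℝ := (lam * (1 + S)) ^ 2 * K2 + ((1 + S) * C0) ^ 2 + (2 * f R) ^ 2 with hK
  refine ⟨c / 2, Kf * c + K, by positivity, by positivity, fun M hM =>
    ⟨fun x => M * f (U x) / (M + f (U x)), fun x => ⟨?_, ?_⟩, fun x => ?_⟩⟩
  · have := hfnn (U x); positivity
  · have := hfnn (U x)
    rw [div_le_iff₀ (by positivity)]; nlinarith
  set u : ℤ := U x with hu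
  set E : ℝ := Real.exp (-(lam * |(u : ℝ)|)) with hE
  have hE0 : 0 < E := Real.exp_pos _
  have hE1 : E ≤ 1 := Real.exp_le_one_iff.2 (by simp; positivity)
  have hEinv : Real.exp (lam * |(u : ℝ)|) * E = 1 := by rw [hE, ← Real.exp_add]; simp
  have hfin : ∀ {I : ℝ}, M * f u / (M + f u) + c / 2 * E - (2 * f u * (c / 2 * E) + K) / M ≤ I →
      M * f u / (M + f u) + c / 2 * E - (Kf * c + K) / M ≤ I := by
    intro I hI
    refine le_trans ?_ hI
    -- The potential grows no faster than the gain decays, so the truncation loss `2 * a * h / M` is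
    -- uniformly `O(1 / M)`.
    have : f u * E ≤ Kf := by
      calc f u * E ≤ Kf * Real.exp (lam * |(u : ℝ)|) * E := by gcongr; exact hfK u
        _ = Kf := by rw [mul_assoc, hEinv, mul_one]
    have h3 : 2 * f u * (c / 2 * E) ≤ Kf * c := by nlinarith
    gcongr
  apply hfin
  by_cases hin : -(R : ℤ) < u ∧ u < R
  -- Near the origin the minorant keeps only the upward jump: `f (u + 1)` on `A` and `0` elsewhere.
  · set A : Set (Fin d → ℤ) := {y | u + 1 ≤ U y} with hA
    have hAm : MeasurableSet A := Set.Countable.measurableSet (Set.to_countable _)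
    have hκA : κ ≤ (q x).toMeasure.real A := by
      have := hup x
      rwa [← hu, ← hA, ENNReal.ofReal_le_iff_le_toReal (measure_ne_top _ _)] at this
    have hfu1 : f (u + 1) ≤ f R := hmono (by omega)
    have hfu : f u ≤ f R := hmono (by omega)
    have hn1 := hfnn (u + 1)
    have hn := hfnn u
    have hbound : ∀ y, (A.indicator (fun _ => f (u + 1)) y - f u) ^ 2 ≤ (2 * f R) ^ 2 := by
      intro y
      have : 0 ≤ A.indicator (fun _ => f (u + 1)) y ∧ A.indicator (fun _ => f (u + 1)) y ≤ f R := by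
        by_cases hy : y ∈ A
        · simp [hy, hn1, hfu1]
        · simp [hy, hn.trans hfu]
      nlinarith
    have hZ2 : Integrable (fun y => (A.indicator (fun _ => f (u + 1)) y - f u) ^ 2)
        (q x).toMeasure :=
      Integrable.of_bound (C := (2 * f R) ^ 2) (measurable_of_countable _).aestronglyMeasurable
        (Filter.Eventually.of_forall fun y => by
          rw [Real.norm_of_nonneg (sq_nonneg _)]; exact hbound y)
    refine truncation_step (Z := A.indicator fun _ => f (u + 1)) (V := fun y => f (U y))
      ((integrable_const _).indicator hAm) hZ2 (measurable_of_countable _) ?_ ?_ hn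
      (by positivity) ?_ ?_ hM
    · exact fun y => Set.indicator_nonneg (fun _ _ => hn1) y
    · intro y
      by_cases hy : y ∈ A
      · rw [Set.indicator_of_mem hy]; exact hmono hy
      · rw [Set.indicator_of_notMem hy]; exact hfnn _
    · rw [integral_indicator hAm]
      simp only [integral_const, measureReal_restrict_apply_univ, smul_eq_mul]
      have h3 := hmid u hin.1 hin.2
      have h4 := mul_le_mul_of_nonneg_right hκA hn1
      nlinarith
    · refine (integral_mono hZ2 (integrable_const ((2 * f R) ^ 2)) hbound).trans ?_
      simp only [integral_const, probReal_univ, one_smul]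
      rw [hK]
      have : 0 ≤ (lam * (1 + S)) ^ 2 * K2 + ((1 + S) * C0) ^ 2 := by positivity
      linarith
  -- On the left the minorant with `S' = 0` is taken: there the second term gives no gain, while
  -- keeping it would put the factor `1 + S` into the error.
  · obtain ⟨S', hS', hS'S, hSR, hfS', hfu⟩ : ∃ S' : ℝ, 0 ≤ S' ∧ S' ≤ S ∧ (S' = 0 ∨ (R : ℝ) ≤ u) ∧
        (∀ v : ℤ, comparison lam R S' v ≤ f v) ∧ f u = comparison lam R S' u := by
      rcases le_or_gt u (-R) with h | h
      · exact ⟨0, le_rfl, hS, Or.inl rfl, hf0, hleft u h⟩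
      · have h' : (R : ℤ) ≤ u := by omega
        exact ⟨S, hS, le_rfl, Or.inr (by exact_mod_cast h'), hfS, hright u h'⟩
    have hRu : (R : ℝ) ≤ |(u : ℝ)| := by
      have : (R : ℤ) ≤ |u| := by
        rw [le_abs]; omega
      exact_mod_cast this
    obtain ⟨π, hπ1, hπ2, hπA⟩ := hcoup x
    set A : Set ((Fin d → ℤ) × (Fin d → ℤ)) := {p | p.1 ≠ p.2} with hA
    have hAm : MeasurableSet A := Set.Countable.measurableSet (Set.to_countable _)
    have hm1 : (q x).toMeasure = π.toMeasure.map Prod.fst := by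
      rw [PMF.toMeasure_map _ _ measurable_fst, hπ1]
    have hm2 : (qbar x).toMeasure = π.toMeasure.map Prod.snd := by
      rw [PMF.toMeasure_map _ _ measurable_snd, hπ2]
    -- As `4 * lam ≤ α`, coupling fails with probability at most `r²` for `r = C0 * E ^ 2`. The
    -- resulting error is of order `E ^ 2`, against a gain of order `E`.
    have hr : 0 < C0 * E ^ 2 := by positivity
    have hPA : π.toMeasure.real A ≤ (C0 * E ^ 2) ^ 2 := by
      have h3 : π.toMeasure.real A ≤ C * Real.exp (-α * latticeNorm x) :=
        ENNReal.toReal_le_of_le_ofReal (by positivity) hπA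
      refine h3.trans ?_
      rw [mul_pow, hC0sq, ← pow_mul, hE, ← Real.exp_nat_mul]
      refine mul_le_mul_of_nonneg_left (Real.exp_le_exp.2 ?_) hC.le
      have := hU x
      rw [← hu] at this
      push_cast
      nlinarith [abs_nonneg (u : ℝ), mul_le_mul hlamα this (abs_nonneg _) (by linarith)]
    have hX := h2 x
    rw [hm2, integral_map (measurable_of_countable _).aemeasurable
      (measurable_of_countable _).aestronglyMeasurable,
      integrable_map_measure (measurable_of_countable _).aestronglyMeasurable
      (measurable_of_countable _).aemeasurable] at hX
    have hLip : 0 ≤ lam * (1 + S') := by positivity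
    obtain ⟨hZ, hZ2, hZ2K, hEZ⟩ := indicator_compl_estimates (P := π.toMeasure)
      (X := fun p => (U p.2 : ℝ)) (g := comparison lam R S') (A := A) (u := (u : ℝ))
      (measurable_of_countable _) hX.1 hX.2 hAm hr hPA (comparison_nonneg hS')
      (comparison_mono hlam hS').measurable hLip (fun v => abs_comparison_sub_le hlam hS' v u)
    have hmean := le_integral_comparison (P := (qbar x).toMeasure) (U := U) (u := u) hlam hc.le hS'
      hR1' hSR (fun b => hdrift b x)
    rw [hm2, integral_map measurable_snd.aemeasurable
      (measurable_of_countable _).aestronglyMeasurable] at hmean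
    have hgu : comparison lam R S' u * E ≤ 1 + S' := by
      calc _ ≤ (1 + S') * Real.exp (lam * |(u : ℝ)|) * E := by
            gcongr; exact comparison_le hlam hR1' hS' _
        _ = 1 + S' := by rw [mul_assoc, hEinv, mul_one]
    have hgu0 := comparison_nonneg (lam := lam) (R := R) hS' (u : ℝ)
    rw [hm1, integral_map measurable_fst.aemeasurable
      (measurable_of_countable _).aestronglyMeasurable]
    refine truncation_step (V := fun p => f (U p.1)) (h := c / 2 * E) hZ (by rw [hfu]; exact hZ2)
      (measurable_of_countable _) ?_ ?_ (hfnn u) (by positivity) ?_ ?_ hM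
    · exact fun p => Set.indicator_nonneg (fun _ _ => comparison_nonneg hS' _) p
    · intro p
      by_cases hp : p ∈ A
      · rw [Set.indicator_of_notMem (by simpa using hp)]; exact hfnn _
      · have hp' : p.1 = p.2 := by simpa [hA] using hp
        rw [Set.indicator_of_mem (by simpa using hp), Function.comp_apply, hp']
        exact hfS' _
    · refine le_trans ?_ hEZ
      rw [hfu]
      have hER : E ≤ Real.exp (-(lam * R)) := by rw [hE]; gcongr
      have h3 : comparison lam R S' u * (C0 * E ^ 2) ^ 2 ≤ (1 + S') * C0 ^ 2 * (E * E) := by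
        calc comparison lam R S' u * (C0 * E ^ 2) ^ 2
            = comparison lam R S' u * E * C0 ^ 2 * (E * E) * E := by ring
          _ ≤ (1 + S') * C0 ^ 2 * (E * E) * 1 := by gcongr
          _ = _ := by ring
      have h4 : (C0 ^ 2 + lam * (K2 + 1) * C0) * E ≤ c / 2 := le_trans (by gcongr) hR
      have h5 : (1 + S') * E * ((C0 ^ 2 + lam * (K2 + 1) * C0) * E) ≤ (1 + S') * E * (c / 2) := by
        gcongr
      have h6 : 0 ≤ S' * (c / 2 * E) := by positivity
      linarith
    · rw [hfu]
      refine hZ2K.trans ?_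
      rw [hK]
      have h3 : comparison lam R S' u ^ 2 * (C0 * E ^ 2) ^ 2 ≤ ((1 + S) * C0) ^ 2 := by
        calc comparison lam R S' u ^ 2 * (C0 * E ^ 2) ^ 2
            = (comparison lam R S' u * E * C0 * E) ^ 2 := by ring
          _ ≤ ((1 + S) * C0 * 1) ^ 2 := by gcongr; linarith
          _ = _ := by ring
      have h4 : (lam * (1 + S')) ^ 2 * K2 ≤ (lam * (1 + S)) ^ 2 * K2 := by gcongr
      have := sq_nonneg (2 * f R)
      linarith

/-! ### One-step laws and telescoping along the chain. -/

namespace IsMarkovChainFrom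

variable {q : (Fin d → ℤ) → PMF (Fin d → ℤ)} {z : Fin d → ℤ} {Ω : Type*} [MeasurableSpace Ω]
  {P : Measure Ω} {Y : ℕ → Ω → (Fin d → ℤ)}

lemma measure_path_inter (hY : IsMarkovChainFrom q z P Y) (n : ℕ) (w : ℕ → (Fin d → ℤ))
    (y : Fin d → ℤ) :
    P ({ω | ∀ k ≤ n, Y k ω = w k} ∩ {ω | Y (n + 1) ω = y}) =
      P {ω | ∀ k ≤ n, Y k ω = w k} * q (w n) y := by
  have h1 := hY.law (n + 1) (fun k => if k ≤ n then w k else y)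
  have h2 : {ω | ∀ k ≤ n + 1, Y k ω = if k ≤ n then w k else y} =
      {ω | ∀ k ≤ n, Y k ω = w k} ∩ {ω | Y (n + 1) ω = y} := by
    ext ω
    simp only [Set.mem_ofPred_eq, Set.mem_inter_iff]
    constructor
    · intro h
      refine ⟨fun k hk => by simpa [hk] using h k (by omega), by simpa using h (n + 1) le_rfl⟩
    · rintro ⟨h, h'⟩ k hk
      split_ifs with hk'
      · exact h k hk'
      · rw [show k = n + 1 by omega, h']
  rw [h2, Finset.prod_range_succ] at h1
  have h3 : ∏ k ∈ Finset.range n, q (if k ≤ n then w k else y) (if k + 1 ≤ n then w (k + 1) else y)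
      = ∏ k ∈ Finset.range n, q (w k) (w (k + 1)) := by
    refine Finset.prod_congr rfl fun k hk => ?_
    have := Finset.mem_range.1 hk
    rw [if_pos (by omega), if_pos (by omega)]
  rw [h1, h3, hY.law n w]
  simp

/-- Only laws of whole paths are given, so the event is split over the countably many paths up to
time `n`. -/
lemma measure_succ (hY : IsMarkovChainFrom q z P Y) (n : ℕ) (x y : Fin d → ℤ) :
    P ({ω | Y n ω = x} ∩ {ω | Y (n + 1) ω = y}) = P {ω | Y n ω = x} * q x y := by
  let ext' : (Fin (n + 1) → (Fin d → ℤ)) → ℕ → (Fin d → ℤ) :=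
    fun w k => if h : k < n + 1 then w ⟨k, h⟩ else 0
  let path : Ω → (Fin (n + 1) → (Fin d → ℤ)) := fun ω k => Y k ω
  have hpath : Measurable path := measurable_pi_lambda _ fun k => hY.measurable k
  have hfib : ∀ w, path ⁻¹' {w} = {ω | ∀ k ≤ n, Y k ω = ext' w k} := by
    intro w
    ext ω
    simp only [Set.mem_preimage, Set.mem_singleton_iff, Set.mem_ofPred_eq, path, ext', funext_iff]
    constructor
    · intro h k hk
      rw [dif_pos (by omega)]
      exact h ⟨k, by omega⟩
    · intro h k
      have := h k (by omega)
      rw [dif_pos k.2] at this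
      exact this
  have hmeas : ∀ k (v : Fin d → ℤ), MeasurableSet {ω | Y k ω = v} := fun k v =>
    hY.measurable k (measurableSet_singleton v)
  have hdecomp : ∀ S : Set Ω, MeasurableSet S → P S = ∑' w, P (S ∩ path ⁻¹' {w}) := by
    intro S hS
    rw [← measure_iUnion]
    · congr 1; ext ω; simp
    · intro w w' hww'
      refine Set.disjoint_left.2 fun ω h h' => hww' ?_
      exact (Set.mem_singleton_iff.1 h.2).symm.trans (Set.mem_singleton_iff.1 h'.2)
    · exact fun w => hS.inter (hpath (measurableSet_singleton w))
  rw [hdecomp _ ((hmeas n x).inter (hmeas (n + 1) y)), hdecomp _ (hmeas n x),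
    ← ENNReal.tsum_mul_right]
  refine tsum_congr fun w => ?_
  rw [hfib]
  by_cases hw : ext' w n = x
  · have h1 : {ω | Y n ω = x} ∩ {ω | ∀ k ≤ n, Y k ω = ext' w k} =
        {ω | ∀ k ≤ n, Y k ω = ext' w k} :=
      Set.inter_eq_right.2 fun ω h => (h n le_rfl).trans hw
    rw [Set.inter_right_comm, h1, hY.measure_path_inter, hw]
  · have h1 : {ω | Y n ω = x} ∩ {ω | ∀ k ≤ n, Y k ω = ext' w k} = ∅ := by
      ext ω
      simp only [Set.mem_inter_iff, Set.mem_ofPred_eq, Set.mem_empty_iff_false, iff_false, not_and]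
      exact fun h h' => hw ((h' n le_rfl).symm.trans h)
    rw [Set.inter_right_comm, h1]
    simp

lemma map_succ (hY : IsMarkovChainFrom q z P Y) (n : ℕ) :
    P.map (Y (n + 1)) = (P.map (Y n)).bind fun x => (q x).toMeasure := by
  refine Measure.ext_of_singleton fun y => ?_
  rw [Measure.bind_apply (measurableSet_singleton y) (measurable_of_countable _).aemeasurable,
    lintegral_countable', Measure.map_apply (hY.measurable _) (measurableSet_singleton y)]
  have hdecomp : P (Y (n + 1) ⁻¹' {y}) =
      ∑' x, P ({ω | Y n ω = x} ∩ {ω | Y (n + 1) ω = y}) := by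
    rw [← measure_iUnion]
    · congr 1; ext ω; simp
    · intro w w' hww'
      exact Set.disjoint_left.2 fun ω h h' => hww' (h.1.symm.trans h'.1)
    · exact fun x => (hY.measurable n (measurableSet_singleton x)).inter
        (hY.measurable (n + 1) (measurableSet_singleton y))
  rw [hdecomp]
  refine tsum_congr fun x => ?_
  rw [hY.measure_succ, PMF.toMeasure_apply_singleton _ _ (measurableSet_singleton _),
    Measure.map_apply (hY.measurable _) (measurableSet_singleton x), mul_comm]
  rfl

lemma integral_succ (hY : IsMarkovChainFrom q z P Y) (n : ℕ) {F : (Fin d → ℤ) → ℝ} {M : ℝ}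
    (hF0 : ∀ x, 0 ≤ F x) (hFM : ∀ x, F x ≤ M) :
    ∫ ω, F (Y (n + 1) ω) ∂P = ∫ ω, ∫ y, F y ∂(q (Y n ω)).toMeasure ∂P := by
  have := hY.isProbabilityMeasure
  have hF : Measurable F := measurable_of_countable _
  have hFi : ∀ x, Integrable F (q x).toMeasure := fun x =>
    Integrable.of_bound (C := M) hF.aestronglyMeasurable
      (Filter.Eventually.of_forall fun y => by rw [Real.norm_of_nonneg (hF0 y)]; exact hFM y)
  have hqF0 : ∀ x, 0 ≤ ∫ y, F y ∂(q x).toMeasure := fun x => integral_nonneg hF0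
  rw [integral_eq_lintegral_of_nonneg_ae (Filter.Eventually.of_forall fun ω => hF0 _)
      (hF.comp (hY.measurable _)).aestronglyMeasurable,
    integral_eq_lintegral_of_nonneg_ae (Filter.Eventually.of_forall fun ω => hqF0 _)
      ((measurable_of_countable fun x => ∫ y, F y ∂(q x).toMeasure).comp
        (hY.measurable n)).aestronglyMeasurable]
  congr 1
  rw [← lintegral_map (f := fun y => ENNReal.ofReal (F y)) (measurable_of_countable _)
      (hY.measurable _), hY.map_succ,
    Measure.lintegral_bind (measurable_of_countable _).aemeasurable
      (measurable_of_countable _).aemeasurable,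
    lintegral_map (measurable_of_countable _) (hY.measurable n)]
  refine lintegral_congr fun ω => ?_
  rw [ofReal_integral_eq_lintegral_ofReal (hFi _) (Filter.Eventually.of_forall hF0)]

/-- The drift inequality, integrated at each time `k`, telescopes; only `0 ≤ F ≤ M` is needed at the
two ends. -/
lemma sum_integral_le (hY : IsMarkovChainFrom q z P Y) {F g : (Fin d → ℤ) → ℝ} {M ε : ℝ}
    (hF0 : ∀ x, 0 ≤ F x) (hFM : ∀ x, F x ≤ M) (hg : ∀ k, Integrable (fun ω => g (Y k ω)) P)
    (hdrift : ∀ x, F x + g x - ε ≤ ∫ y, F y ∂(q x).toMeasure) (n : ℕ) :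
    ∑ k ∈ Finset.range n, ∫ ω, g (Y k ω) ∂P ≤ M + n * ε := by
  have := hY.isProbabilityMeasure
  have hFi : ∀ k, Integrable (fun ω => F (Y k ω)) P := fun k =>
    Integrable.of_bound (C := M)
      ((measurable_of_countable F).comp (hY.measurable k)).aestronglyMeasurable
      (Filter.Eventually.of_forall fun ω => by rw [Real.norm_of_nonneg (hF0 _)]; exact hFM _)
  have hqFi : ∀ k, Integrable (fun ω => ∫ y, F y ∂(q (Y k ω)).toMeasure) P := fun k => by
    refine Integrable.of_bound (C := M)
      ((measurable_of_countable fun x => ∫ y, F y ∂(q x).toMeasure).comp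
        (hY.measurable k)).aestronglyMeasurable (Filter.Eventually.of_forall fun ω => ?_)
    refine (norm_integral_le_of_norm_le_const (C := M) (Filter.Eventually.of_forall fun y => ?_)).trans
      (by simp)
    rw [Real.norm_of_nonneg (hF0 y)]; exact hFM y
  have hstep : ∀ k, ∫ ω, g (Y k ω) ∂P ≤
      (∫ ω, F (Y (k + 1) ω) ∂P - ∫ ω, F (Y k ω) ∂P) + ε := by
    intro k
    have hFg : Integrable (fun ω => F (Y k ω) + g (Y k ω)) P := (hFi k).add (hg k)
    have h := integral_mono (hFg.sub (integrable_const ε)) (hqFi k) fun ω => hdrift (Y k ω)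
    rw [← hY.integral_succ k hF0 hFM] at h
    simp only [Pi.sub_apply] at h
    rw [integral_sub hFg (integrable_const ε), integral_add (hFi k) (hg k)] at h
    simp only [integral_const, probReal_univ, one_smul] at h
    linarith
  refine (Finset.sum_le_sum fun k _ => hstep k).trans ?_
  rw [Finset.sum_add_distrib, Finset.sum_range_sub (fun k => ∫ ω, F (Y k ω) ∂P)]
  have h0 : 0 ≤ ∫ ω, F (Y 0 ω) ∂P := integral_nonneg fun ω => hF0 _
  have hn : ∫ ω, F (Y n ω) ∂P ≤ M := by
    refine (integral_mono (hFi n) (integrable_const M) fun ω => hFM _).trans (by simp)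
  simp only [Finset.sum_const, Finset.card_range, nsmul_eq_mul]
  linarith

lemma hasSum_integral (hY : IsMarkovChainFrom q z P Y) {h : (Fin d → ℤ) → ℝ} (k : ℕ)
    (hint : Integrable (fun ω => h (Y k ω)) P) :
    HasSum (fun y => h y * P.real {ω | Y k ω = y}) (∫ ω, h (Y k ω) ∂P) := by
  have hs := hasSum_integral_iUnion (μ := P) (f := fun ω => h (Y k ω))
    (s := fun y => {ω | Y k ω = y}) (fun y => hY.measurable k (measurableSet_singleton y))
    (fun y y' hyy' => Set.disjoint_left.2 fun ω h1 h2 => hyy' (h1.symm.trans h2)) hint.integrableOn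
  have huniv : (⋃ y, {ω | Y k ω = y}) = Set.univ := by ext ω; simp
  rw [huniv, setIntegral_univ] at hs
  convert! hs using 2 with y
  rw [setIntegral_congr_fun (s := {ω | Y k ω = y}) (g := fun _ => h y) (hY.measurable k (measurableSet_singleton y))
    (fun ω hω => by rw [show Y k ω = y from hω])]
  simp [mul_comm]

end IsMarkovChainFrom

/-! ### Choice of the coordinate and conclusion. -/

lemma abs_apply_le_latticeNorm (x : Fin d → ℤ) (j : Fin d) : |(x j : ℝ)| ≤ latticeNorm x := by
  have := PiLp.norm_apply_le (p := 2) (WithLp.toLp 2 fun i => (x i : ℝ)) j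
  simpa [latticeNorm] using this

/-- The chain has a signed coordinate that moves up with uniformly positive probability and that
is nondegenerate for the random walk. -/
lemma exists_signed_coordinate {q qbar : (Fin d → ℤ) → PMF (Fin d → ℤ)}
    (hq : UniformlyNondegenerate q) (hq' : DegenerateCoordinatesCompatible q qbar) :
    ∃ (U : (Fin d → ℤ) →+ ℤ) (κ : ℝ) (e : Fin d → ℤ), (∀ x, |(U x : ℝ)| ≤ latticeNorm x) ∧
      0 < κ ∧ (∀ x, ENNReal.ofReal κ ≤ (q x).toMeasure {y | U x + 1 ≤ U y}) ∧
      qbar 0 e ≠ 0 ∧ U e ≠ 0 := by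
  obtain ⟨j, κ, hκ, hj⟩ := hq
  have hdeg : ∃ e : Fin d → ℤ, qbar 0 e ≠ 0 ∧ e j ≠ 0 := by
    -- If the walk never moved coordinate `j`, neither would the chain, against the lower bound `κ`
    -- on its jump probability.
    by_contra! hcon
    have hzero := hq' j fun y hy => by_contra fun h => hy (hcon y h)
    have hnull : ∀ S : Set (Fin d → ℤ), (∀ y ∈ S, (0 : Fin d → ℤ) j ≠ y j) →
        (q 0).toMeasure S = 0 := by
      intro S hS
      rw [PMF.toMeasure_apply_eq_zero_iff _ (Set.Countable.measurableSet (Set.to_countable _))]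
      refine Set.disjoint_left.2 fun y hy hyS => ?_
      exact (PMF.mem_support_iff _ _).1 hy (hzero 0 y (hS y hyS))
    have hpos : 0 < ENNReal.ofReal κ := ENNReal.ofReal_pos.2 hκ
    rcases hj with h | h
    · refine absurd (h 0) (not_le.2 ?_)
      rwa [hnull _ fun y hy => ?_]
      have : 1 ≤ y j - (0 : Fin d → ℤ) j := hy
      omega
    · refine absurd (h 0) (not_le.2 ?_)
      rwa [hnull _ fun y hy => ?_]
      have : y j - (0 : Fin d → ℤ) j ≤ -1 := hy
      omega
  obtain ⟨e, he, hej⟩ := hdeg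
  rcases hj with h | h
  · refine ⟨Pi.evalAddMonoidHom _ j, κ, e, fun x => abs_apply_le_latticeNorm x j, hκ,
      fun x => (h x).trans (measure_mono fun y hy => ?_), he, hej⟩
    simp only [Set.mem_ofPred_eq, Pi.evalAddMonoidHom_apply] at hy ⊢
    omega
  · refine ⟨-Pi.evalAddMonoidHom _ j, κ, e, fun x => ?_, hκ,
      fun x => (h x).trans (measure_mono fun y hy => ?_), he, by simpa using hej⟩
    · simpa using abs_apply_le_latticeNorm x j
    · simp only [Set.mem_ofPred_eq, AddMonoidHom.neg_apply, Pi.evalAddMonoidHom_apply] at hy ⊢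
      omega

theorem theoremA1 {d : ℕ} (q qbar : (Fin d → ℤ) → PMF (Fin d → ℤ))
    (hwalk : IsSymmetricRandomWalk qbar)
    (hAi : HasThirdMoment qbar)
    (hAii : UniformlyNondegenerate q)
    (hAii' : DegenerateCoordinatesCompatible q qbar)
    (hAiii : ExponentiallyCoupled q qbar)
    (h : (Fin d → ℤ) → ℝ) (Ch α₂ : ℝ) (hCh : 0 < Ch) (hα₂ : 0 < α₂)
    (h_nonneg : ∀ x, 0 ≤ h x)
    (h_le : ∀ x, h x ≤ Ch * Real.exp (-α₂ * latticeNorm x)) :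
    ∃ C η : ℝ, 0 < C ∧ 0 < η ∧
      ∀ (z : Fin d → ℤ) (Ω : Type*) [MeasurableSpace Ω] (P : Measure Ω)
        (Y : ℕ → Ω → (Fin d → ℤ)), IsMarkovChainFrom q z P Y →
        (∀ k, Integrable (fun ω => h (Y k ω)) P) ∧
        ∀ n : ℕ, 1 ≤ n →
          HasSum (fun y => h y * ∑ k ∈ Finset.range n, P.real {ω | Y k ω = y})
            (∑ k ∈ Finset.range n, ∫ ω, h (Y k ω) ∂P) ∧
          ∑ k ∈ Finset.range n, ∫ ω, h (Y k ω) ∂P ≤ C * (n : ℝ) ^ (1 - η) := by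
  obtain ⟨U, κ, e, hU, hκ, hup, he, hUe⟩ := exists_signed_coordinate hAii hAii'
  obtain ⟨C₁, α₁, hC₁, hα₁, hcoup⟩ := hAiii
  obtain ⟨lam, hlam, hlam1, hlam2⟩ : ∃ lam : ℝ, 0 < lam ∧ 4 * lam ≤ α₁ ∧ lam ≤ α₂ :=
    ⟨min (α₁ / 4) α₂, lt_min (by positivity) hα₂, by linarith [min_le_left (α₁ / 4) α₂],
      min_le_right _ _⟩
  obtain ⟨c, K, hc, hK, hlyap⟩ := exists_lyapunov hwalk hAi U hU hκ hup he hUe hC₁ hlam hlam1 hcoup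
  have hhg : ∀ x, c / Ch * h x ≤ c * Real.exp (-(lam * |(U x : ℝ)|)) := by
    intro x
    have h1 : lam * |(U x : ℝ)| ≤ α₂ * latticeNorm x :=
      mul_le_mul hlam2 (hU x) (abs_nonneg _) hα₂.le
    calc c / Ch * h x ≤ c / Ch * (Ch * Real.exp (-α₂ * latticeNorm x)) := by
          gcongr; exact h_le x
      _ = c * Real.exp (-α₂ * latticeNorm x) := by field_simp
      _ ≤ _ := by gcongr; linarith
  have hhC : ∀ x, h x ≤ Ch := fun x => by
    have h1 : 0 ≤ latticeNorm x := norm_nonneg _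
    have h2 : Real.exp (-α₂ * latticeNorm x) ≤ 1 := Real.exp_le_one_iff.2 (by nlinarith)
    nlinarith [h_le x]
  refine ⟨Ch / c * (1 + K), 1 / 2, by positivity, by norm_num, fun z Ω _ P Y hY => ?_⟩
  have hP := hY.isProbabilityMeasure
  have hint : ∀ k, Integrable (fun ω => h (Y k ω)) P := fun k =>
    Integrable.of_bound (C := Ch)
      ((measurable_of_countable h).comp (hY.measurable k)).aestronglyMeasurable
      (Filter.Eventually.of_forall fun ω => by
        rw [Real.norm_of_nonneg (h_nonneg _)]; exact hhC _)
  refine ⟨hint, fun n hn => ⟨?_, ?_⟩⟩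
  · simp only [Finset.mul_sum]
    exact hasSum_sum fun k _ => hY.hasSum_integral k (hint k)
  · have hn0 : (0 : ℝ) < n := by exact_mod_cast hn
    have hs : 0 < Real.sqrt n := Real.sqrt_pos.2 hn0
    -- The level `√n` balances `M` against `n * K / M`; the Lyapunov function thus depends on `n`,
    -- but `c` and `K` do not.
    obtain ⟨F, hF, hFd⟩ := hlyap (Real.sqrt n) hs
    have hsum := hY.sum_integral_le (g := fun x => c / Ch * h x) (ε := K / Real.sqrt n)
      (fun x => (hF x).1) (fun x => (hF x).2) (fun k => (hint k).const_mul _)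
      (fun x => le_trans (by linarith [hhg x]) (hFd x)) n
    simp only [integral_const_mul, ← Finset.mul_sum] at hsum
    have h1 : (n : ℝ) * (K / Real.sqrt n) = K * Real.sqrt n := by
      rw [mul_div_assoc', mul_comm, mul_div_assoc, Real.div_sqrt]
    rw [h1] at hsum
    rw [show (1 : ℝ) - 1 / 2 = 1 / 2 by norm_num, ← Real.sqrt_eq_rpow]
    calc ∑ k ∈ Finset.range n, ∫ ω, h (Y k ω) ∂P
        = Ch / c * (c / Ch * ∑ k ∈ Finset.range n, ∫ ω, h (Y k ω) ∂P) := by field_simp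
      _ ≤ Ch / c * (Real.sqrt n + K * Real.sqrt n) := by gcongr
      _ = _ := by ring
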